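/- Let $(M,g)$ be a smooth Riemannian manifold of dimension $n>2$ with Levi-Civita connection $\nabla$, and let $\xi$ be a smooth vector field on $M$ with $g(\xi,\xi)=1$ and $\nabla\xi=0$. Put $\pi(X)=g(X,\xi)$, $\phi=\tfrac12\pi$, $\psi=\tfrac{n-1}{2(n+1)}\pi$, and let $\tilde\nabla$ be the projective semi-symmetric connection $$\tilde\nabla_XY=\nabla_XY+\psi(Y)X+\psi(X)Y+\phi(Y)X-\phi(X)Y .$$ For a connection $D$ write $R^D(X,Y)Z=D_XD_YZ-D_YD_XZ-D_{[X,Y]}Z$, and let $R=R^{\nabla}$, $\tilde R=R^{\tilde\nabla}$. Suppose that $M$ is semi-symmetric for $\tilde\nabla$, i.e. $\tilde R\cdot\tilde R=0$: for all $X,Y,Z,U,V$, $$\tilde R(X,Y)\tilde R(Z,U)V-\tilde R(\tilde R(X,Y)Z,U)V-\tilde R(Z,\tilde R(X,Y)U)V-\tilde R(Z,U)\tilde R(X,Y)V=0 .$$ Then $\nabla$ is flat: $R=0$. Hence $M$ is projectively, conformally, concircularly, conharmonically, quasi-conformally and $m$-projectively flat for $\nabla$. That is, with the Ricci tensor $S(Y,Z)=\operatorname{tr}(X\mapsto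 R(X,Y)Z)$, the Ricci operator $Q$ ($g(QX,Y)=S(X,Y)$), the scalar curvature $r=\operatorname{tr}Q$, and $$G(X,Y)Z=g(Y,Z)X-g(X,Z)Y,\qquad A(X,Y)Z=S(Y,Z)X-S(X,Z)Y,\qquad B(X,Y)Z=g(Y,Z)QX-g(X,Z)QY,$$ the following tensors vanish identically: - the projective curvature tensor $R-\frac1{n-1}A$; - the conformal curvature tensor $R-\frac1{n-2}(A+B)+\frac{r}{(n-1)(n-2)}G$ and, if $n=3$, also the Cotton tensor $(\nabla_XL)(Y,Z)-(\nabla_YL)(X,Z)$ of $L=\frac1{n-2}\bigl(S-\frac{r}{2(n-1)}g\bigr)$; - the concircular curvature tensor $R-\frac{r}{n(n-1)}G$; - the conharmonic curvature tensor $R-\frac1{n-2}(A+B)$; - the quasi-conformal curvature tensor $aR+b(A+B)-\frac rn\bigl(\frac a{n-1}+2b\bigr)G$, for all real constants $a,b$; - the $m$-projective curvature tensor $R-\frac1{2(n-1)}(A+B)$. -/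

import Mathlib

open Bundle VectorField
open scoped Manifold ContDiff RealInnerProductSpace

noncomputable section

namespace RiemCurv

section

variable {n : ℕ} {M : Type*} [TopologicalSpace M] [ChartedSpace (EuclideanSpace ℝ (Fin n)) M]
  [IsManifold (𝓡 n) ∞ M]

/-- Linear (affine) connections on `M`: covariant derivatives on the tangent bundle.
Mathlib writes `(∇_X Y)(x)` as `D Y x (X x)`. -/
abbrev Connection (n : ℕ) (M : Type*) [TopologicalSpace M]
    [ChartedSpace (EuclideanSpace ℝ (Fin n)) M] [IsManifold (𝓡 n) ∞ M] :=
  CovariantDerivative (𝓡 n) (EuclideanSpace ℝ (Fin n)) (fun x : M ↦ TangentSpace (𝓡 n) x)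

/-- The vector field `R(X, Y) Z = ∇_X ∇_Y Z - ∇_Y ∇_X Z - ∇_[X, Y] Z`. -/
def curvField (D : Connection n M) (X Y Z : Π x : M, TangentSpace (𝓡 n) x) (x : M) :
    TangentSpace (𝓡 n) x :=
  D (fun y ↦ D Z y (Y y)) x (X x) - D (fun y ↦ D Z y (X y)) x (Y x)
    - D Z x (mlieBracket (𝓡 n) X Y x)

/-- A vector field that is smooth near `x` and takes the value `v` at `x`: constant in the
trivialization of the tangent bundle at `x`. -/
abbrev extendVec {x : M} (v : TangentSpace (𝓡 n) x) : Π y : M, TangentSpace (𝓡 n) y :=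
  FiberBundle.extend (EuclideanSpace ℝ (Fin n)) v

/-- The curvature tensor `R_x(u, v) w` at the point `x`. By tensoriality the choice of the fields that
extend `u`, `v`, `w` is immaterial. -/
def curv (D : Connection n M) (x : M) (u v w : TangentSpace (𝓡 n) x) : TangentSpace (𝓡 n) x :=
  curvField D (extendVec u) (extendVec v) (extendVec w) x

/-- `R = 0`. -/
def IsFlat (D : Connection n M) : Prop :=
  ∀ (x : M) (u v w : TangentSpace (𝓡 n) x), curv D x u v w = 0

/-- `(R(u, v) . R)(y, z) w`, where `R(u, v)` acts as a derivation on the tensor `R`. -/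
def curvDotCurv (D : Connection n M) (x : M) (u v y z w : TangentSpace (𝓡 n) x) :
    TangentSpace (𝓡 n) x :=
  curv D x u v (curv D x y z w) - curv D x (curv D x u v y) z w
    - curv D x y (curv D x u v z) w - curv D x y z (curv D x u v w)

/-- `R . R = 0`. -/
def IsSemiSymmetric (D : Connection n M) : Prop :=
  ∀ (x : M) (u v y z w : TangentSpace (𝓡 n) x), curvDotCurv D x u v y z w = 0

variable [RiemannianBundle (fun x : M ↦ TangentSpace (𝓡 n) x)]

/-- An orthonormal basis of the tangent space at `x`. -/
def frame (x : M) :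
    OrthonormalBasis (Fin (Module.finrank ℝ (TangentSpace (𝓡 n) x))) ℝ (TangentSpace (𝓡 n) x) :=
  haveI : FiniteDimensional ℝ (TangentSpace (𝓡 n) x) :=
    inferInstanceAs (FiniteDimensional ℝ (EuclideanSpace ℝ (Fin n)))
  stdOrthonormalBasis ℝ (TangentSpace (𝓡 n) x)

/-- The Ricci tensor `S(v, w)`: the trace of `u ↦ R(u, v) w`. -/
def ricci (D : Connection n M) (x : M) (v w : TangentSpace (𝓡 n) x) : ℝ :=
  ∑ i, ⟪curv D x (frame x i) v w, frame x i⟫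

/-- The Ricci operator `Q`, with `g(Q v, w) = S(v, w)`. -/
def ricciOp (D : Connection n M) (x : M) (v : TangentSpace (𝓡 n) x) : TangentSpace (𝓡 n) x :=
  ∑ i, ricci D x v (frame x i) • frame x i

/-- The scalar curvature. -/
def scal (D : Connection n M) (x : M) : ℝ := ∑ i, ricci D x (frame x i) (frame x i)

/-- `g(v, w) u - g(u, w) v`. -/
def gWedge (x : M) (u v w : TangentSpace (𝓡 n) x) : TangentSpace (𝓡 n) x :=
  ⟪v, w⟫ • u - ⟪u, w⟫ • v

/-- `S(v, w) u - S(u, w) v`. -/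
def sWedge (D : Connection n M) (x : M) (u v w : TangentSpace (𝓡 n) x) : TangentSpace (𝓡 n) x :=
  ricci D x v w • u - ricci D x u w • v

/-- `g(v, w) Q u - g(u, w) Q v`. -/
def qWedge (D : Connection n M) (x : M) (u v w : TangentSpace (𝓡 n) x) : TangentSpace (𝓡 n) x :=
  ⟪v, w⟫ • ricciOp D x u - ⟪u, w⟫ • ricciOp D x v

/-- The Weyl projective curvature tensor. -/
def projectiveCurv (D : Connection n M) (x : M) (u v w : TangentSpace (𝓡 n) x) :
    TangentSpace (𝓡 n) x :=
  curv D x u v w - (1 / ((n : ℝ) - 1)) • sWedge D x u v w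

/-- The Weyl conformal curvature tensor. -/
def conformalCurv (D : Connection n M) (x : M) (u v w : TangentSpace (𝓡 n) x) :
    TangentSpace (𝓡 n) x :=
  curv D x u v w - (1 / ((n : ℝ) - 2)) • (sWedge D x u v w + qWedge D x u v w)
    + (scal D x / (((n : ℝ) - 1) * ((n : ℝ) - 2))) • gWedge x u v w

/-- The concircular curvature tensor. -/
def concircularCurv (D : Connection n M) (x : M) (u v w : TangentSpace (𝓡 n) x) :
    TangentSpace (𝓡 n) x :=
  curv D x u v w - (scal D x / ((n : ℝ) * ((n : ℝ) - 1))) • gWedge x u v w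

/-- The conharmonic curvature tensor. -/
def conharmonicCurv (D : Connection n M) (x : M) (u v w : TangentSpace (𝓡 n) x) :
    TangentSpace (𝓡 n) x :=
  curv D x u v w - (1 / ((n : ℝ) - 2)) • (sWedge D x u v w + qWedge D x u v w)

/-- The quasi-conformal curvature tensor with constants `a` and `b`. -/
def quasiConformalCurv (D : Connection n M) (a b : ℝ) (x : M) (u v w : TangentSpace (𝓡 n) x) :
    TangentSpace (𝓡 n) x :=
  a • curv D x u v w + b • (sWedge D x u v w + qWedge D x u v w)
    - (scal D x / (n : ℝ) * (a / ((n : ℝ) - 1) + 2 * b)) • gWedge x u v w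

/-- The `m`-projective curvature tensor. -/
def mProjectiveCurv (D : Connection n M) (x : M) (u v w : TangentSpace (𝓡 n) x) :
    TangentSpace (𝓡 n) x :=
  curv D x u v w - (1 / (2 * ((n : ℝ) - 1))) • (sWedge D x u v w + qWedge D x u v w)

/-- The Schouten tensor `(1 / (n - 2)) (S - r / (2 (n - 1)) g)`. -/
def schouten (D : Connection n M) (x : M) (v w : TangentSpace (𝓡 n) x) : ℝ :=
  (1 / ((n : ℝ) - 2)) * (ricci D x v w - scal D x / (2 * ((n : ℝ) - 1)) * ⟪v, w⟫)

/-- The covariant derivative `(∇_u L)(v, w)` of the Schouten tensor `L`. -/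
def derivSchouten (D : Connection n M) (x : M) (u v w : TangentSpace (𝓡 n) x) : ℝ :=
  mvfderiv (𝓡 n) (fun y ↦ schouten D y (extendVec v y) (extendVec w y)) x u
    - schouten D x (D (extendVec v) x u) w - schouten D x v (D (extendVec w) x u)

/-- The Cotton tensor `(∇_u L)(v, w) - (∇_v L)(u, w)`. -/
def cotton (D : Connection n M) (x : M) (u v w : TangentSpace (𝓡 n) x) : ℝ :=
  derivSchouten D x u v w - derivSchouten D x v u w

/-- `P = 0`. -/
def IsProjectivelyFlat (D : Connection n M) : Prop :=
  ∀ (x : M) (u v w : TangentSpace (𝓡 n) x), projectiveCurv D x u v w = 0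

/-- Conformal flatness: `C = 0`, and the Cotton tensor vanishes too when `n = 3`, the dimension in
which `C` is always zero and does not detect conformal flatness. -/
def IsConformallyFlat (D : Connection n M) : Prop :=
  (∀ (x : M) (u v w : TangentSpace (𝓡 n) x), conformalCurv D x u v w = 0) ∧
    (n = 3 → ∀ (x : M) (u v w : TangentSpace (𝓡 n) x), cotton D x u v w = 0)

/-- The concircular curvature tensor vanishes. -/
def IsConcircularlyFlat (D : Connection n M) : Prop :=
  ∀ (x : M) (u v w : TangentSpace (𝓡 n) x), concircularCurv D x u v w = 0

/-- The conharmonic curvature tensor vanishes. -/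
def IsConharmonicallyFlat (D : Connection n M) : Prop :=
  ∀ (x : M) (u v w : TangentSpace (𝓡 n) x), conharmonicCurv D x u v w = 0

/-- The quasi-conformal curvature tensor vanishes, whatever its two constants are. -/
def IsQuasiConformallyFlat (D : Connection n M) : Prop :=
  ∀ (a b : ℝ) (x : M) (u v w : TangentSpace (𝓡 n) x), quasiConformalCurv D a b x u v w = 0

/-- The `m`-projective curvature tensor vanishes. -/
def IsMProjectivelyFlat (D : Connection n M) : Prop :=
  ∀ (x : M) (u v w : TangentSpace (𝓡 n) x), mProjectiveCurv D x u v w = 0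

/-- The 1-form `π(v) = g(v, ξ)`. -/
def piForm (ξ : Π x : M, TangentSpace (𝓡 n) x) (x : M) (v : TangentSpace (𝓡 n) x) : ℝ := ⟪v, ξ x⟫

/-- `φ = π / 2`. -/
def phiForm (ξ : Π x : M, TangentSpace (𝓡 n) x) (x : M) (v : TangentSpace (𝓡 n) x) : ℝ :=
  1 / 2 * piForm ξ x v

/-- `ψ = ((n - 1) / (2 (n + 1))) π`. -/
def psiForm (ξ : Π x : M, TangentSpace (𝓡 n) x) (x : M) (v : TangentSpace (𝓡 n) x) : ℝ :=
  ((n : ℝ) - 1) / (2 * ((n : ℝ) + 1)) * piForm ξ x v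

/-- `D'` is the projective semi-symmetric connection of `D` and the vector field `ξ`:
`∇'_u Y = ∇_u Y + ψ(Y) u + ψ(u) Y + φ(Y) u - φ(u) Y`. The part symmetric in `u` and `Y` makes it
projectively equivalent to `D`, the skew part gives the torsion `π(Y) u - π(u) Y`. -/
def IsProjectiveSemiSymmetric (D : Connection n M) (ξ : Π x : M, TangentSpace (𝓡 n) x)
    (D' : Connection n M) : Prop :=
  ∀ (Y : Π x : M, TangentSpace (𝓡 n) x) (x : M) (u : TangentSpace (𝓡 n) x),
    MDifferentiableAt (𝓡 n) (𝓡 n).tangent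
      (fun y ↦ (⟨y, Y y⟩ : TangentBundle (𝓡 n) M)) x →
    D' Y x u = D Y x u + psiForm ξ x (Y x) • u + psiForm ξ x u • Y x
      + phiForm ξ x (Y x) • u - phiForm ξ x u • Y x

variable [IsContMDiffRiemannianBundle (𝓡 n) ∞ (EuclideanSpace ℝ (Fin n))
  (fun x : M ↦ TangentSpace (𝓡 n) x)]

set_option synthInstance.maxHeartbeats 400000 in
/-- `D` is the Levi-Civita connection: smooth, metric and torsion-free. -/
structure IsLeviCivita (D : Connection n M) : Prop where
  smooth : D.ContMDiffCovariantDerivative ∞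
  torsionFree : D.torsion = 0
  metric : D.IsMetricCompatible

end

end RiemCurv

end

open scoped Topology

namespace RiemCurv

/-! Write π for g(·, ξ). The sum of ψ and φ is aπ with a = n/(n+1), and ψ - φ is bπ with b =
-1/(n+1), so ∇' differs from ∇ by aπ(Y)X + bπ(X)Y. As ξ is parallel, π is parallel and closed. The
b-terms then drop out of the curvature, leaving R'(X,Y)Z = R(X,Y)Z + a²π(Z)(π(Y)X - π(X)Y)
(`curvField_projectiveSemiSymmetric`).

The rest is algebra in one tangent space (`curvature_eq_zero_of_semiSymmetric`). Parallelism and the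
symmetries of R make R vanish as soon as one argument is ξ. For y, z, u orthogonal to ξ, apply
R'(ξ,y) to R'(z,u)ξ. Since R'(ξ,y) sends w to -a²π(w)y and R'(z,u)ξ = 0, the only surviving term of
R'·R' = 0 is a²R(z,u)y. So R vanishes on the complement of ξ too, hence everywhere.

The symmetries of R are proved for fields smooth near a point: Bianchi from the Jacobi identity,
skew-adjointness from the action of [X,Y] on functions, pair symmetry from these. The other flatness
statements follow because their tensors are built from R and its traces. -/

lemma mvfderiv_congr {n : ℕ} {M : Type*} [TopologicalSpace M]
    [ChartedSpace (EuclideanSpace ℝ (Fin n)) M] {x : M} {f g : M → ℝ} (h : ∀ᶠ y in 𝓝 x, f y = g y) :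
    mvfderiv (𝓡 n) f x = mvfderiv (𝓡 n) g x := by
  ext v
  exact congr($(Filter.EventuallyEq.mfderiv_eq (I := 𝓡 n) (I' := 𝓘(ℝ)) h) v)

/-! ### Vector fields smooth near a point. -/

section VectorFields

variable {n : ℕ} {M : Type*} [TopologicalSpace M] [ChartedSpace (EuclideanSpace ℝ (Fin n)) M]
  [IsManifold (𝓡 n) ∞ M]

lemma isManifold_minSmoothness_two : IsManifold (𝓡 n) (minSmoothness ℝ 2) M := by
  rw [minSmoothness_of_isRCLikeNormedField]
  infer_instance

lemma isManifold_minSmoothness_three : IsManifold (𝓡 n) (minSmoothness ℝ 3) M := by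
  rw [minSmoothness_of_isRCLikeNormedField]
  infer_instance

/-- The vector field `X` is smooth on a neighbourhood of `x`. -/
def SmoothNear (X : Π x : M, TangentSpace (𝓡 n) x) (x : M) : Prop :=
  ∀ᶠ y in 𝓝 x, ContMDiffAt (𝓡 n) (𝓡 n).tangent ∞ (fun y ↦ (⟨y, X y⟩ : TangentBundle (𝓡 n) M)) y

variable {X Y Z : Π x : M, TangentSpace (𝓡 n) x} {x : M}

lemma SmoothNear.contMDiffAt (h : SmoothNear X x) :
    ContMDiffAt (𝓡 n) (𝓡 n).tangent ∞ (fun y ↦ (⟨y, X y⟩ : TangentBundle (𝓡 n) M)) x :=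
  h.self_of_nhds

lemma SmoothNear.mdifferentiableAt (h : SmoothNear X x) :
    MDifferentiableAt (𝓡 n) (𝓡 n).tangent (fun y ↦ (⟨y, X y⟩ : TangentBundle (𝓡 n) M)) x :=
  h.contMDiffAt.mdifferentiableAt (by simp)

lemma SmoothNear.contMDiffAt_minSmoothness (h : SmoothNear X x) :
    ContMDiffAt (𝓡 n) (𝓡 n).tangent (minSmoothness ℝ 2)
      (fun y ↦ (⟨y, X y⟩ : TangentBundle (𝓡 n) M)) x := by
  rw [minSmoothness_of_isRCLikeNormedField]
  exact h.contMDiffAt.of_le (WithTop.coe_le_coe.2 (le_top : (2 : ℕ∞) ≤ ⊤))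

/-- Curvature involves second derivatives, so first-order identities are needed on a whole
neighbourhood of the point; this carries the pointwise rules there. -/
lemma SmoothNear.eventually (h : SmoothNear X x) : ∀ᶠ y in 𝓝 x, SmoothNear X y :=
  eventually_eventually_nhds.2 h

lemma SmoothNear.of_contMDiff
    (h : ContMDiff (𝓡 n) (𝓡 n).tangent ∞ (fun y ↦ (⟨y, X y⟩ : TangentBundle (𝓡 n) M))) :
    SmoothNear X x :=
  .of_forall h

lemma SmoothNear.congr (h : SmoothNear X x) (hY : ∀ᶠ y in 𝓝 x, Y y = X y) : SmoothNear Y x := by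
  filter_upwards [h, hY.eventually_nhds] with y hy hy'
  exact hy.congr_of_eventuallyEq (hy'.mono fun z hz ↦ by simp [hz])

lemma SmoothNear.add (hX : SmoothNear X x) (hY : SmoothNear Y x) : SmoothNear (X + Y) x := by
  filter_upwards [hX, hY] with y hy hy' using hy.add_section hy'

lemma SmoothNear.sub (hX : SmoothNear X x) (hY : SmoothNear Y x) : SmoothNear (X - Y) x := by
  filter_upwards [hX, hY] with y hy hy' using hy.sub_section hy'

lemma SmoothNear.smul {f : M → ℝ} (hf : ∀ᶠ y in 𝓝 x, ContMDiffAt (𝓡 n) 𝓘(ℝ) ∞ f y)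
    (hX : SmoothNear X x) : SmoothNear (f • X) x := by
  filter_upwards [hf, hX] with y hy hy' using hy.smul_section hy'

lemma smoothNear_extendVec (v : TangentSpace (𝓡 n) x) : SmoothNear (extendVec v) x := by
  obtain ⟨s, hs, h⟩ := FiberBundle.exists_contMDiffOn_extend (k := ∞) (𝓡 n)
    (EuclideanSpace ℝ (Fin n)) v
  filter_upwards [eventually_mem_nhds_iff.2 hs] with y hy
  exact h.contMDiffAt hy

lemma SmoothNear.mlieBracket (hX : SmoothNear X x) (hY : SmoothNear Y x) :
    SmoothNear (mlieBracket (𝓡 n) X Y) x := by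
  have := isManifold_minSmoothness_two (n := n) (M := M)
  -- The bracket loses one derivative, which costs nothing because `∞ + 1` is `∞`.
  have : IsManifold (𝓡 n) (((⊤ : ℕ∞) : ℕ∞ω) + 1) M := ‹IsManifold (𝓡 n) ∞ M›
  filter_upwards [hX, hY] with y hy hy'
  exact ContMDiffAt.mlieBracket_vectorField (m := ⊤) (n := ⊤) hy hy' (by simp)

/-- A vector field that is smooth near `x` agrees near `x` with a globally smooth one. -/
lemma SmoothNear.exists_contMDiff [T2Space M] (hX : SmoothNear X x) :
    ∃ Y : Π x : M, TangentSpace (𝓡 n) x,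
      ContMDiff (𝓡 n) (𝓡 n).tangent ∞ (fun y ↦ (⟨y, Y y⟩ : TangentBundle (𝓡 n) M)) ∧
      ∀ᶠ y in 𝓝 x, Y y = X y := by
  obtain ⟨u, hu, hxu, h⟩ : ∃ u, (∀ y ∈ u, ContMDiffAt (𝓡 n) (𝓡 n).tangent ∞
      (fun y ↦ (⟨y, X y⟩ : TangentBundle (𝓡 n) M)) y) ∧ IsOpen u ∧ x ∈ u :=
    eventually_nhds_iff.1 hX
  -- A bump function supported where `X` is smooth: `f • X` is smooth everywhere and equals `X` near
  -- `x`.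
  obtain ⟨f, hf⟩ := (SmoothBumpFunction.nhds_basis_tsupport (I := 𝓡 n) x).mem_iff.1
    (hxu.mem_nhds h)
  refine ⟨(f : M → ℝ) • X, ?_, ?_⟩
  · exact ContMDiffOn.smul_section_of_tsupport (f.contMDiff.contMDiffOn) hxu hf.2
      (fun y hy ↦ (hu y hy).contMDiffWithinAt)
  · filter_upwards [f.eventuallyEq_one] with y hy
    simp [hy]

/-- Writing the extension through linear maps makes its additivity and homogeneity in `v` visible.
-/
lemma eventually_extendVec_eq_symmₗ (v : TangentSpace (𝓡 n) x) :
    letI t := trivializationAt (EuclideanSpace ℝ (Fin n)) (fun x : M ↦ TangentSpace (𝓡 n) x) x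
    ∀ᶠ y in 𝓝 x, extendVec v y = t.symmₗ ℝ y (t.linearMapAt ℝ x v) := by
  have hx := FiberBundle.mem_baseSet_trivializationAt' (F := EuclideanSpace ℝ (Fin n))
    (E := fun x : M ↦ TangentSpace (𝓡 n) x) x
  filter_upwards [(trivializationAt (EuclideanSpace ℝ (Fin n))
    (fun x : M ↦ TangentSpace (𝓡 n) x) x).open_baseSet.mem_nhds hx] with y hy
  rw [Trivialization.coe_linearMapAt_of_mem _ hx, Trivialization.symmₗ_apply _ hy]
  rfl

lemma eventually_extendVec_add (v w : TangentSpace (𝓡 n) x) :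
    ∀ᶠ y in 𝓝 x, extendVec (v + w) y = (extendVec v + extendVec w) y := by
  filter_upwards [eventually_extendVec_eq_symmₗ (v + w), eventually_extendVec_eq_symmₗ v,
    eventually_extendVec_eq_symmₗ w] with y h h₁ h₂
  rw [Pi.add_apply, h, h₁, h₂, map_add, map_add]

lemma eventually_extendVec_smul (c : ℝ) (v : TangentSpace (𝓡 n) x) :
    ∀ᶠ y in 𝓝 x, extendVec (c • v) y = (c • extendVec v) y := by
  filter_upwards [eventually_extendVec_eq_symmₗ (c • v), eventually_extendVec_eq_symmₗ v]
    with y h h₁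
  rw [Pi.smul_apply, h, h₁, map_smul, map_smul]

end VectorFields

end RiemCurv

namespace RiemCurv

/-! ### Curvature of a connection: linearity, swap symmetry, first Bianchi identity. -/

section Connections

variable {n : ℕ} {M : Type*} [TopologicalSpace M] [ChartedSpace (EuclideanSpace ℝ (Fin n)) M]
  [IsManifold (𝓡 n) ∞ M]

variable {X Y Z W : Π x : M, TangentSpace (𝓡 n) x} {x : M} {D : Connection n M}

lemma covariantDerivative_congr (hY : SmoothNear Y x) (h : ∀ᶠ y in 𝓝 x, Z y = Y y) :
    D Z x = D Y x :=
  D.isCovariantDerivativeOn.congr_of_eventuallyEq (hY.congr h).mdifferentiableAt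
    hY.mdifferentiableAt Filter.univ_mem h

lemma eventually_covariantDerivative_congr (hY : SmoothNear Y x) (h : ∀ᶠ y in 𝓝 x, Z y = Y y) :
    ∀ᶠ y in 𝓝 x, D Z y = D Y y := by
  filter_upwards [hY.eventually, h.eventually_nhds] with y hy hy'
  exact covariantDerivative_congr hy hy'

lemma covariantDerivative_add (hY : SmoothNear Y x) (hZ : SmoothNear Z x) :
    D (Y + Z) x = D Y x + D Z x :=
  D.isCovariantDerivativeOnUniv.add hY.mdifferentiableAt hZ.mdifferentiableAt

lemma covariantDerivative_smul {f : M → ℝ} (hf : MDifferentiableAt (𝓡 n) 𝓘(ℝ) f x)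
    (hY : SmoothNear Y x) (v : TangentSpace (𝓡 n) x) :
    D (f • Y) x v = f x • D Y x v + mvfderiv (𝓡 n) f x v • Y x := by
  rw [D.isCovariantDerivativeOnUniv.leibniz hY.mdifferentiableAt hf]
  rfl

lemma covariantDerivative_const_smul (c : ℝ) (hY : SmoothNear Y x) :
    D (c • Y) x = c • D Y x :=
  D.isCovariantDerivativeOnUniv.smul_const c hY.mdifferentiableAt

lemma covariantDerivative_sub (hY : SmoothNear Y x) (hZ : SmoothNear Z x) :
    D (Y - Z) x = D Y x - D Z x := by
  have h := covariantDerivative_add (D := D) (hY.sub hZ) hZ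
  rw [sub_add_cancel] at h
  rw [h, add_sub_cancel_right]

lemma SmoothNear.const_smul (c : ℝ) (hX : SmoothNear X x) : SmoothNear (c • X) x :=
  SmoothNear.smul (f := fun _ ↦ c) (.of_forall fun _ ↦ contMDiffAt_const) hX

/-- Smoothness of `D` is applied to a global smooth field that agrees with `Z` near `x`; locality of
`D` brings the result back to `Z`. -/
lemma SmoothNear.covariantDerivative [T2Space M]
    (hD : D.ContMDiffCovariantDerivative ∞) (hX : SmoothNear X x) (hZ : SmoothNear Z x) :
    SmoothNear (fun y ↦ D Z y (X y)) x := by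
  obtain ⟨Z', hZ', h⟩ := hZ.exists_contMDiff
  have h' := eventually_covariantDerivative_congr (D := D) hZ h
  have hs := hD.contMDiff.contMDiff (σ := Z') (hZ'.contMDiffOn)
  refine SmoothNear.congr (Y := fun y ↦ D Z y (X y)) (X := fun y ↦ D Z' y (X y)) ?_
    (h'.mono fun y hy ↦ by rw [hy])
  filter_upwards [hX] with y hy
  exact (hs.contMDiffAt Filter.univ_mem).clm_bundle_apply hy

lemma curvField_congr_right [T2Space M] (hD : D.ContMDiffCovariantDerivative ∞)
    (hX : SmoothNear X x) (hY : SmoothNear Y x) (hZ : SmoothNear Z x)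
    (h : ∀ᶠ y in 𝓝 x, W y = Z y) : curvField D X Y W x = curvField D X Y Z x := by
  have h' := eventually_covariantDerivative_congr (D := D) hZ h
  have key {V : Π x : M, TangentSpace (𝓡 n) x} (hV : SmoothNear V x) :
      D (fun y ↦ D W y (V y)) x = D (fun y ↦ D Z y (V y)) x :=
    covariantDerivative_congr (hV.covariantDerivative hD hZ) (h'.mono fun y hy ↦ by rw [hy])
  unfold curvField
  rw [key hX, key hY, h'.self_of_nhds]

lemma curvField_add_right [T2Space M] (hD : D.ContMDiffCovariantDerivative ∞)
    (hX : SmoothNear X x) (hY : SmoothNear Y x) (hZ : SmoothNear Z x) (hW : SmoothNear W x) :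
    curvField D X Y (Z + W) x = curvField D X Y Z x + curvField D X Y W x := by
  have h : ∀ᶠ y in 𝓝 x, D (Z + W) y = D Z y + D W y := by
    filter_upwards [hZ.eventually, hW.eventually] with y hy hy'
    exact covariantDerivative_add hy hy'
  have key {V : Π x : M, TangentSpace (𝓡 n) x} (hV : SmoothNear V x) :
      D (fun y ↦ D (Z + W) y (V y)) x =
        D (fun y ↦ D Z y (V y)) x + D (fun y ↦ D W y (V y)) x := by
    have hZ' := hV.covariantDerivative hD hZ
    have hW' := hV.covariantDerivative hD hW
    rw [← covariantDerivative_add hZ' hW', covariantDerivative_congr (hZ'.add hW')]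
    filter_upwards [h] with y hy
    rw [hy]
    rfl
  unfold curvField
  rw [key hX, key hY, h.self_of_nhds]
  simp only [_root_.add_apply]
  abel

lemma curvField_const_smul_right [T2Space M] (hD : D.ContMDiffCovariantDerivative ∞)
    (hX : SmoothNear X x) (hY : SmoothNear Y x) (c : ℝ) (hZ : SmoothNear Z x) :
    curvField D X Y (c • Z) x = c • curvField D X Y Z x := by
  have h : ∀ᶠ y in 𝓝 x, D (c • Z) y = c • D Z y :=
    hZ.eventually.mono fun y hy ↦ covariantDerivative_const_smul c hy
  have key {V : Π x : M, TangentSpace (𝓡 n) x} (hV : SmoothNear V x) :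
      D (fun y ↦ D (c • Z) y (V y)) x = c • D (fun y ↦ D Z y (V y)) x := by
    have hZ' := hV.covariantDerivative hD hZ
    rw [← covariantDerivative_const_smul c hZ', covariantDerivative_congr (hZ'.const_smul c)]
    filter_upwards [h] with y hy
    rw [hy]
    rfl
  unfold curvField
  rw [key hX, key hY, h.self_of_nhds]
  simp only [_root_.smul_apply, smul_sub]

lemma curv_add_right [T2Space M] (hD : D.ContMDiffCovariantDerivative ∞)
    (u v w z : TangentSpace (𝓡 n) x) :
    curv D x u v (w + z) = curv D x u v w + curv D x u v z := by
  have h := smoothNear_extendVec (n := n) (M := M) (x := x)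
  unfold curv
  rw [← curvField_add_right hD (h u) (h v) (h w) (h z)]
  exact curvField_congr_right hD (h u) (h v) ((h w).add (h z)) (eventually_extendVec_add w z)

lemma curv_smul_right [T2Space M] (hD : D.ContMDiffCovariantDerivative ∞) (c : ℝ)
    (u v w : TangentSpace (𝓡 n) x) :
    curv D x u v (c • w) = c • curv D x u v w := by
  have h := smoothNear_extendVec (n := n) (M := M) (x := x)
  unfold curv
  rw [← curvField_const_smul_right hD (h u) (h v) c (h w)]
  exact curvField_congr_right hD (h u) (h v) ((h w).const_smul c) (eventually_extendVec_smul c w)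

lemma curv_swap (u v w : TangentSpace (𝓡 n) x) : curv D x v u w = -curv D x u v w := by
  unfold curv curvField
  rw [mlieBracket_swap_apply, map_neg]
  abel

/-- The Lie derivative of functions turns the Lie bracket into a commutator. It is enough that
some vector field does not vanish at `x`, because of the Jacobi identity for `X`, `Y`, `f • Z`. -/
lemma mvfderiv_mlieBracket {f : M → ℝ} (hX : SmoothNear X x) (hY : SmoothNear Y x)
    (hZ : SmoothNear Z x) (hZx : Z x ≠ 0)
    (hf : ∀ᶠ y in 𝓝 x, ContMDiffAt (𝓡 n) 𝓘(ℝ) ∞ f y)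
    (hfX : MDifferentiableAt (𝓡 n) 𝓘(ℝ) (fun y ↦ mvfderiv (𝓡 n) f y (X y)) x)
    (hfY : MDifferentiableAt (𝓡 n) 𝓘(ℝ) (fun y ↦ mvfderiv (𝓡 n) f y (Y y)) x) :
    mvfderiv (𝓡 n) f x (mlieBracket (𝓡 n) X Y x) =
      mvfderiv (𝓡 n) (fun y ↦ mvfderiv (𝓡 n) f y (Y y)) x (X x) -
        mvfderiv (𝓡 n) (fun y ↦ mvfderiv (𝓡 n) f y (X y)) x (Y x) := by
  have := isManifold_minSmoothness_two (n := n) (M := M)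
  have := isManifold_minSmoothness_three (n := n) (M := M)
  have hf' : MDifferentiableAt (𝓡 n) 𝓘(ℝ) f x := hf.self_of_nhds.mdifferentiableAt (by simp)
  have leib {V : Π x : M, TangentSpace (𝓡 n) x} : ∀ᶠ y in 𝓝 x, mlieBracket (𝓡 n) V (f • Z) y =
      ((fun y ↦ mvfderiv (𝓡 n) f y (V y)) • Z + f • mlieBracket (𝓡 n) V Z) y := by
    filter_upwards [hf, hZ.eventually] with y hy hy'
    exact mlieBracket_smul_right (hy.mdifferentiableAt (by simp)) hy'.mdifferentiableAt
  have leib₂ {U V : Π x : M, TangentSpace (𝓡 n) x} (hV : SmoothNear V x)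
      (hfV : MDifferentiableAt (𝓡 n) 𝓘(ℝ) (fun y ↦ mvfderiv (𝓡 n) f y (V y)) x) :
      mlieBracket (𝓡 n) U (mlieBracket (𝓡 n) V (f • Z)) x =
        mvfderiv (𝓡 n) (fun y ↦ mvfderiv (𝓡 n) f y (V y)) x (U x) • Z x +
        mvfderiv (𝓡 n) f x (V x) • mlieBracket (𝓡 n) U Z x +
        (mvfderiv (𝓡 n) f x (U x) • mlieBracket (𝓡 n) V Z x +
          f x • mlieBracket (𝓡 n) U (mlieBracket (𝓡 n) V Z) x) := by
    have hVZ := hV.mlieBracket hZ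
    rw [Filter.EventuallyEq.mlieBracket_vectorField_eq (Filter.EventuallyEq.refl _ U) leib,
      mlieBracket_add_right (hfV.smul_section hZ.mdifferentiableAt)
        (hf'.smul_section hVZ.mdifferentiableAt),
      mlieBracket_smul_right hfV hZ.mdifferentiableAt,
      mlieBracket_smul_right hf' hVZ.mdifferentiableAt]
  have jac {V : Π x : M, TangentSpace (𝓡 n) x} (hV : SmoothNear V x) :=
    leibniz_identity_mlieBracket_apply (I := 𝓡 n) hX.contMDiffAt_minSmoothness
      hY.contMDiffAt_minSmoothness hV.contMDiffAt_minSmoothness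
  have h := jac (hZ.smul hf)
  rw [leib₂ hY hfY, leib₂ hX hfX, leib.self_of_nhds, jac hZ] at h
  -- Jacobi for X, Y, fZ minus f times Jacobi for X, Y, Z: the terms with a single derivative of f
  -- cancel in pairs, leaving a multiple of Z.
  have h' : (mvfderiv (𝓡 n) f x (mlieBracket (𝓡 n) X Y x) -
      (mvfderiv (𝓡 n) (fun y ↦ mvfderiv (𝓡 n) f y (Y y)) x (X x) -
        mvfderiv (𝓡 n) (fun y ↦ mvfderiv (𝓡 n) f y (X y)) x (Y x))) • Z x = 0 := by
    simp only [Pi.add_apply, Pi.smul_apply', smul_add] at h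
    refine Eq.trans ?_ (sub_eq_zero.2 h.symm)
    module
  exact sub_eq_zero.1 ((smul_eq_zero.1 h').resolve_right hZx)

/-- The first Bianchi identity for a torsion-free connection. -/
lemma curvField_cyclic_sum [T2Space M] (hD : D.ContMDiffCovariantDerivative ∞)
    (ht : D.torsion = 0) (hX : SmoothNear X x) (hY : SmoothNear Y x) (hZ : SmoothNear Z x) :
    curvField D X Y Z x + curvField D Y Z X x + curvField D Z X Y x = 0 := by
  have := isManifold_minSmoothness_two (n := n) (M := M)
  have := isManifold_minSmoothness_three (n := n) (M := M)
  have tor {U V : Π x : M, TangentSpace (𝓡 n) x} {y : M} (hU : SmoothNear U y)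
      (hV : SmoothNear V y) : D V y (U y) - D U y (V y) = mlieBracket (𝓡 n) U V y :=
    D.torsion_eq_zero_iff.1 ht hU.mdifferentiableAt hV.mdifferentiableAt
  -- Vanishing torsion, used twice, gives ∇_T(∇_U V - ∇_V U) - ∇_[U,V] T = [T,[U,V]]. The cyclic sum
  -- regroups into three such expressions, and Jacobi finishes.
  have key {T U V : Π x : M, TangentSpace (𝓡 n) x} (hT : SmoothNear T x) (hU : SmoothNear U x)
      (hV : SmoothNear V x) :
      D (fun y ↦ D V y (U y)) x (T x) - D (fun y ↦ D U y (V y)) x (T x) -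
        D T x (mlieBracket (𝓡 n) U V x) = mlieBracket (𝓡 n) T (mlieBracket (𝓡 n) U V) x := by
    have h := hU.mlieBracket hV
    rw [← tor hT h, ← _root_.sub_apply,
      ← covariantDerivative_sub (hU.covariantDerivative hD hV) (hV.covariantDerivative hD hU),
      covariantDerivative_congr (Z := (fun y ↦ D V y (U y)) - fun y ↦ D U y (V y)) h]
    filter_upwards [hU.eventually, hV.eventually] with y hy hy' using tor hy hy'
  have jac := leibniz_identity_mlieBracket_apply (I := 𝓡 n) hX.contMDiffAt_minSmoothness
    hY.contMDiffAt_minSmoothness hZ.contMDiffAt_minSmoothness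
  rw [mlieBracket_swap_apply (V := mlieBracket (𝓡 n) X Y), ← key hX hY hZ, ← key hY hX hZ,
    ← key hZ hX hY] at jac
  unfold curvField
  rw [mlieBracket_swap_apply (V := Z), map_neg]
  refine Eq.trans ?_ (sub_eq_zero.2 jac)
  abel

end Connections

end RiemCurv

namespace RiemCurv

/-! ### Metric compatibility and the curvature of the projective semi-symmetric connection. -/

section Metric

variable {n : ℕ} {M : Type*} [TopologicalSpace M] [ChartedSpace (EuclideanSpace ℝ (Fin n)) M]
  [IsManifold (𝓡 n) ∞ M] [RiemannianBundle (fun x : M ↦ TangentSpace (𝓡 n) x)]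
  [IsContMDiffRiemannianBundle (𝓡 n) ∞ (EuclideanSpace ℝ (Fin n))
    (fun x : M ↦ TangentSpace (𝓡 n) x)]

variable {X Y Z W : Π x : M, TangentSpace (𝓡 n) x} {x : M} {D D' : Connection n M}

lemma SmoothNear.inner (hY : SmoothNear Y x) (hZ : SmoothNear Z x) :
    ∀ᶠ y in 𝓝 x, ContMDiffAt (𝓡 n) 𝓘(ℝ) ∞ (fun y ↦ ⟪Y y, Z y⟫) y := by
  filter_upwards [hY, hZ] with y hy hy' using hy.inner_bundle hy'

lemma SmoothNear.mdifferentiableAt_inner (hY : SmoothNear Y x) (hZ : SmoothNear Z x) :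
    MDifferentiableAt (𝓡 n) 𝓘(ℝ) (fun y ↦ ⟪Y y, Z y⟫) x :=
  (hY.inner hZ).self_of_nhds.mdifferentiableAt (by simp)

set_option synthInstance.maxHeartbeats 400000 in
lemma mvfderiv_inner (hD : IsLeviCivita D) (hY : SmoothNear Y x) (hZ : SmoothNear Z x)
    (v : TangentSpace (𝓡 n) x) :
    mvfderiv (𝓡 n) (fun y ↦ ⟪Y y, Z y⟫) x v = ⟪D Y x v, Z x⟫ + ⟪Y x, D Z x v⟫ := by
  have h := hD.metric.mvfderiv_inner_eq (extendVec v) hY.mdifferentiableAt hZ.mdifferentiableAt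
  simpa using h

/-- The curvature of a metric connection is skew-adjoint. -/
lemma inner_curvField_add_inner_curvField [T2Space M] (hD : IsLeviCivita D)
    {V : Π x : M, TangentSpace (𝓡 n) x} (hV : SmoothNear V x) (hVx : V x ≠ 0)
    (hX : SmoothNear X x) (hY : SmoothNear Y x) (hZ : SmoothNear Z x) (hW : SmoothNear W x) :
    ⟪curvField D X Y Z x, W x⟫ + ⟪Z x, curvField D X Y W x⟫ = 0 := by
  have first {U : Π x : M, TangentSpace (𝓡 n) x} :
      ∀ᶠ y in 𝓝 x, mvfderiv (𝓡 n) (fun y ↦ ⟪Z y, W y⟫) y (U y) =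
        ⟪D Z y (U y), W y⟫ + ⟪Z y, D W y (U y)⟫ := by
    filter_upwards [hZ.eventually, hW.eventually] with y hy hy'
    exact mvfderiv_inner hD hy hy' (U y)
  have diff {U : Π x : M, TangentSpace (𝓡 n) x} (hU : SmoothNear U x) :
      MDifferentiableAt (𝓡 n) 𝓘(ℝ) (fun y ↦ mvfderiv (𝓡 n) (fun y ↦ ⟪Z y, W y⟫) y (U y)) x :=
    (((hU.covariantDerivative hD.smooth hZ).mdifferentiableAt_inner hW).add
      (hZ.mdifferentiableAt_inner (hU.covariantDerivative hD.smooth hW))).congr_of_eventuallyEq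
      first
  have second {U : Π x : M, TangentSpace (𝓡 n) x} (hU : SmoothNear U x)
      (v : TangentSpace (𝓡 n) x) :
      mvfderiv (𝓡 n) (fun y ↦ mvfderiv (𝓡 n) (fun y ↦ ⟪Z y, W y⟫) y (U y)) x v =
        ⟪D (fun y ↦ D Z y (U y)) x v, W x⟫ + ⟪D Z x (U x), D W x v⟫ +
          (⟪D Z x v, D W x (U x)⟫ + ⟪Z x, D (fun y ↦ D W y (U y)) x v⟫) := by
    have hUZ := hU.covariantDerivative hD.smooth hZ
    have hUW := hU.covariantDerivative hD.smooth hW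
    rw [mvfderiv_congr first,
      mvfderiv_fun_add (hUZ.mdifferentiableAt_inner hW) (hZ.mdifferentiableAt_inner hUW),
      _root_.add_apply, mvfderiv_inner hD hUZ hW, mvfderiv_inner hD hZ hUW]
  -- [X,Y] acts on g(Z,W) as a commutator; the products of first derivatives are symmetric in X and
  -- Y, so only curvature terms remain.
  have h := mvfderiv_mlieBracket hX hY hV hVx (hZ.inner hW) (diff hX) (diff hY)
  rw [second hX, second hY, mvfderiv_inner hD hZ hW] at h
  simp only [curvField, inner_sub_left, inner_sub_right]
  linarith

variable {ξ : Π x : M, TangentSpace (𝓡 n) x}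

/-- The curvature of the projective semi-symmetric connection of a parallel field `ξ`. -/
lemma curvField_projectiveSemiSymmetric [T2Space M] (hD : IsLeviCivita D)
    (hξ : ∀ x, SmoothNear ξ x) (hξ_parallel : ∀ (x : M) (v : TangentSpace (𝓡 n) x), D ξ x v = 0)
    (hD' : IsProjectiveSemiSymmetric D ξ D')
    (hX : SmoothNear X x) (hY : SmoothNear Y x) (hZ : SmoothNear Z x) :
    curvField D' X Y Z x = curvField D X Y Z x +
      ((n : ℝ) / (n + 1)) ^ 2 • ⟪Z x, ξ x⟫ • (⟪Y x, ξ x⟫ • X x - ⟪X x, ξ x⟫ • Y x) := by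
  -- The coefficients of π in ψ + φ and in ψ - φ.
  obtain ⟨a, ha⟩ : ∃ a : ℝ, a = n / (n + 1) := ⟨_, rfl⟩
  obtain ⟨b, hb⟩ : ∃ b : ℝ, b = -1 / (n + 1) := ⟨_, rfl⟩
  have hn : (n : ℝ) + 1 ≠ 0 := by positivity
  have form {U : Π x : M, TangentSpace (𝓡 n) x} {y : M} (hU : SmoothNear U y)
      (v : TangentSpace (𝓡 n) y) :
      D' U y v = D U y v + (a * ⟪U y, ξ y⟫) • v + (b * ⟪v, ξ y⟫) • U y := by
    rw [hD' U y v hU.mdifferentiableAt]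
    have h₁ : a = (n - 1) / (2 * (n + 1)) + 1 / 2 := by rw [ha]; field_simp; ring
    have h₂ : b = (n - 1) / (2 * (n + 1)) - 1 / 2 := by rw [hb]; field_simp; ring
    unfold psiForm phiForm piForm
    rw [h₁, h₂]
    module
  -- Only one term, since `ξ` is parallel.
  have dpi {U : Π x : M, TangentSpace (𝓡 n) x} (hU : SmoothNear U x)
      (v : TangentSpace (𝓡 n) x) (c : ℝ) :
      mvfderiv (𝓡 n) (fun y ↦ c * ⟪U y, ξ y⟫) x v = c * ⟪D U x v, ξ x⟫ := by
    have h := mvfderiv_inner hD (hU.const_smul c) (hξ x) v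
    simpa [hξ_parallel, inner_smul_left, covariantDerivative_const_smul c hU] using h
  have smooth_pi {U : Π x : M, TangentSpace (𝓡 n) x} (hU : SmoothNear U x) (c : ℝ) :
      ∀ᶠ y in 𝓝 x, ContMDiffAt (𝓡 n) 𝓘(ℝ) ∞ (fun y ↦ c * ⟪U y, ξ y⟫) y :=
    (hU.inner (hξ x)).mono fun y hy ↦ contMDiffAt_const.mul hy
  have second {U V : Π x : M, TangentSpace (𝓡 n) x} (hU : SmoothNear U x)
      (hV : SmoothNear V x) :
      D' (fun y ↦ D' Z y (V y)) x (U x) =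
        D (fun y ↦ D Z y (V y)) x (U x) +
          ((a * ⟪Z x, ξ x⟫) • D V x (U x) + (a * ⟪D Z x (U x), ξ x⟫) • V x) +
          ((b * ⟪V x, ξ x⟫) • D Z x (U x) + (b * ⟪D V x (U x), ξ x⟫) • Z x) +
        (a * (⟪D Z x (V x), ξ x⟫ + a * ⟪Z x, ξ x⟫ * ⟪V x, ξ x⟫ +
          b * ⟪V x, ξ x⟫ * ⟪Z x, ξ x⟫)) • U x +
        (b * ⟪U x, ξ x⟫) • (D Z x (V x) + (a * ⟪Z x, ξ x⟫) • V x + (b * ⟪V x, ξ x⟫) • Z x) := by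
    have h₁ := hV.covariantDerivative hD.smooth hZ
    have h₂ := SmoothNear.smul (smooth_pi hZ a) hV
    have h₃ := SmoothNear.smul (smooth_pi hV b) hZ
    have hG := (h₁.add h₂).add h₃
    have hm {U : Π x : M, TangentSpace (𝓡 n) x} (hU : SmoothNear U x) (c : ℝ) :=
      (smooth_pi hU c).self_of_nhds.mdifferentiableAt (by simp)
    have e : ∀ᶠ y in 𝓝 x, D' Z y (V y) = ((fun y ↦ D Z y (V y)) +
        (fun y ↦ a * ⟪Z y, ξ y⟫) • V + (fun y ↦ b * ⟪V y, ξ y⟫) • Z) y :=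
      hZ.eventually.mono fun y hy ↦ form hy (V y)
    rw [covariantDerivative_congr hG e, form hG, covariantDerivative_add (h₁.add h₂) h₃,
      covariantDerivative_add h₁ h₂]
    simp only [_root_.add_apply, covariantDerivative_smul (hm hZ a) hV,
      covariantDerivative_smul (hm hV b) hZ, dpi hZ, dpi hV, Pi.add_apply, Pi.smul_apply',
      inner_add_left, inner_smul_left, conj_trivial]
  have tor : D Y x (X x) - D X x (Y x) = mlieBracket (𝓡 n) X Y x :=
    D.torsion_eq_zero_iff.1 hD.torsionFree hX.mdifferentiableAt hY.mdifferentiableAt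
  unfold curvField
  -- In the difference the ab- and b²-terms are symmetric and cancel; the terms in ∇_X Y - ∇_Y X
  -- cancel against those from [X,Y]. Only a² survives.
  rw [second hX hY, second hY hX, form hZ, ← tor, ← ha]
  simp only [inner_sub_left]
  module

end Metric

end RiemCurv

namespace RiemCurv

/-! ### Algebraic curvature tensors on an inner product space. -/

section Algebraic

variable {E : Type*} [NormedAddCommGroup E] [InnerProductSpace ℝ E] {R : E → E → E → E}

/-- The pair symmetry of algebraic curvature tensors. -/
lemma inner_pair_symm (hswap : ∀ u v w, R v u w = -R u v w)
    (hskew : ∀ u v w z, ⟪R u v w, z⟫ = -⟪w, R u v z⟫)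
    (hbianchi : ∀ u v w, R u v w + R v w u + R w u v = 0) (u v w z : E) :
    ⟪R u v w, z⟫ = ⟪R w z u, v⟫ := by
  have b (u v w z : E) : ⟪R u v w, z⟫ + ⟪R v w u, z⟫ + ⟪R w u v, z⟫ = 0 := by
    rw [← inner_add_left, ← inner_add_left, hbianchi, inner_zero_left]
  have s (u v w z : E) : ⟪R v u w, z⟫ = -⟪R u v w, z⟫ := by rw [hswap, inner_neg_left]
  have k (u v w z : E) : ⟪R u v w, z⟫ = -⟪R u v z, w⟫ := by rw [hskew, real_inner_comm]
  -- The octahedron argument: four Bianchi identities, combined through skewness in the first and in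
  -- the last pair.
  linarith [b u v w z, b v w z u, b w z u v, b z u v w, k u v w z, k v w u z, k w u v z,
    k w z u v, k z u w v, k v z w u, s v z w u, s u w v z, s w u v z, s u w z v, k u w z v]

/-- If a curvature tensor annihilates a unit vector `ξ`, and its sum with
`(u, v, w) ↦ c g(w, ξ) (g(v, ξ) u - g(u, ξ) v)` is semi-symmetric, then it is zero. -/
lemma curvature_eq_zero_of_semiSymmetric (hadd : ∀ u v w z, R u v (w + z) = R u v w + R u v z)
    (hsmul : ∀ (a : ℝ) u v w, R u v (a • w) = a • R u v w)
    (hswap : ∀ u v w, R v u w = -R u v w)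
    (hskew : ∀ u v w z, ⟪R u v w, z⟫ = -⟪w, R u v z⟫)
    (hbianchi : ∀ u v w, R u v w + R v w u + R w u v = 0)
    {ξ : E} (hunit : ⟪ξ, ξ⟫ = 1) (hξ : ∀ u v w, ⟪R u v w, ξ⟫ = 0) {c : ℝ} (hc : c ≠ 0)
    {R' : E → E → E → E}
    (hR' : ∀ u v w, R' u v w = R u v w + c • ⟪w, ξ⟫ • (⟪v, ξ⟫ • u - ⟪u, ξ⟫ • v))
    (hss : ∀ u v y z w, R' u v (R' y z w) - R' (R' u v y) z w - R' y (R' u v z) w -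
      R' y z (R' u v w) = 0) (u v w : E) : R u v w = 0 := by
  have right (u v : E) : R u v ξ = 0 := by
    refine ext_inner_right ℝ fun z ↦ ?_
    rw [hskew, real_inner_comm, hξ, neg_zero, inner_zero_left]
  have left (v w : E) : R ξ v w = 0 := by
    refine ext_inner_right ℝ fun z ↦ ?_
    rw [inner_pair_symm hswap hskew hbianchi, right, inner_zero_left, inner_zero_left]
  have orth {y z u : E} (hy : ⟪y, ξ⟫ = 0) (hz : ⟪z, ξ⟫ = 0) (hu : ⟪u, ξ⟫ = 0) :
      R z u y = 0 := by
    have e (w : E) : R' ξ y w = -(c * ⟪w, ξ⟫) • y := by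
      rw [hR', left, hy, hunit]
      module
    have e₁ (z u : E) : R' z u ξ = c • (⟪u, ξ⟫ • z - ⟪z, ξ⟫ • u) := by
      rw [hR', right, hunit]
      module
    -- The decisive instance: three of its four terms vanish by orthogonality to `ξ`.
    have h := hss ξ y z u ξ
    have e₂ : R' z u (-(c * 1) • y) = -c • R z u y := by
      rw [hR', hsmul, inner_smul_left, hy]
      simp
    rw [e, e, e, e, e₁ z u, hz, hu, hunit, e₂] at h
    have h' : c • R z u y = 0 := by
      simpa [e₁, inner_sub_left, inner_smul_left, hz, hu] using h
    exact (smul_eq_zero.1 h').resolve_left hc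
  have orth_proj (w : E) : ⟪w - ⟪w, ξ⟫ • ξ, ξ⟫ = 0 := by
    rw [inner_sub_left, inner_smul_left, hunit]
    simp
  have proj (u v w : E) : R u v w = R u v (w - ⟪w, ξ⟫ • ξ) := by
    conv_lhs => rw [← sub_add_cancel w (⟪w, ξ⟫ • ξ), hadd, hsmul, right, smul_zero, add_zero]
  -- Linearity is available only in the third slot. Skewness and pair symmetry bring `z`, `w` and
  -- `u` there in turn, to be stripped of their `ξ`-components; `v` need not be, as `orth` involves
  -- three vectors.
  refine ext_inner_right ℝ fun z ↦ ?_
  rw [inner_zero_left, hskew, proj u v z, ← hskew, proj,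
    inner_pair_symm hswap hskew hbianchi, proj, orth (orth_proj _) (orth_proj _) (orth_proj _),
    inner_zero_left]

end Algebraic

end RiemCurv

namespace RiemCurv

/-! ### Consequences of flatness. -/

section Flat

variable {n : ℕ} {M : Type*} [TopologicalSpace M] [ChartedSpace (EuclideanSpace ℝ (Fin n)) M]
  [IsManifold (𝓡 n) ∞ M] [RiemannianBundle (fun x : M ↦ TangentSpace (𝓡 n) x)]
  {D : Connection n M} {x : M}

lemma IsFlat.ricci_eq_zero (h : IsFlat D) (v w : TangentSpace (𝓡 n) x) : ricci D x v w = 0 := by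
  simp [ricci, h x]

lemma IsFlat.ricciOp_eq_zero (h : IsFlat D) (v : TangentSpace (𝓡 n) x) : ricciOp D x v = 0 := by
  simp [ricciOp, h.ricci_eq_zero]

lemma IsFlat.scal_eq_zero (h : IsFlat D) : scal D x = 0 := by
  simp [scal, h.ricci_eq_zero]

lemma IsFlat.sWedge_eq_zero (h : IsFlat D) (u v w : TangentSpace (𝓡 n) x) :
    sWedge D x u v w = 0 := by
  simp [sWedge, h.ricci_eq_zero]

lemma IsFlat.qWedge_eq_zero (h : IsFlat D) (u v w : TangentSpace (𝓡 n) x) :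
    qWedge D x u v w = 0 := by
  simp [qWedge, h.ricciOp_eq_zero]

lemma IsFlat.schouten_eq_zero (h : IsFlat D) (v w : TangentSpace (𝓡 n) x) :
    schouten D x v w = 0 := by
  simp [schouten, h.ricci_eq_zero, h.scal_eq_zero]

lemma IsFlat.derivSchouten_eq_zero (h : IsFlat D) (u v w : TangentSpace (𝓡 n) x) :
    derivSchouten D x u v w = 0 := by
  -- The Schouten tensor vanishes at every point, so its derivative does too.
  have h₀ : (fun y ↦ schouten D y (extendVec v y) (extendVec w y)) = fun _ ↦ 0 :=
    funext fun y ↦ h.schouten_eq_zero _ _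
  rw [derivSchouten, h₀, h.schouten_eq_zero, h.schouten_eq_zero, mvfderiv, mfderiv_const]
  simp

lemma IsFlat.isProjectivelyFlat (h : IsFlat D) : IsProjectivelyFlat D := fun x u v w ↦ by
  simp [projectiveCurv, h x, h.sWedge_eq_zero]

lemma IsFlat.isConformallyFlat (h : IsFlat D) : IsConformallyFlat D :=
  ⟨fun x u v w ↦ by
    simp [conformalCurv, h x, h.sWedge_eq_zero, h.qWedge_eq_zero, h.scal_eq_zero],
  fun _ x u v w ↦ by simp [cotton, h.derivSchouten_eq_zero]⟩

lemma IsFlat.isConcircularlyFlat (h : IsFlat D) : IsConcircularlyFlat D := fun x u v w ↦ by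
  simp [concircularCurv, h x, h.scal_eq_zero]

lemma IsFlat.isConharmonicallyFlat (h : IsFlat D) : IsConharmonicallyFlat D := fun x u v w ↦ by
  simp [conharmonicCurv, h x, h.sWedge_eq_zero, h.qWedge_eq_zero]

lemma IsFlat.isQuasiConformallyFlat (h : IsFlat D) : IsQuasiConformallyFlat D :=
  fun a b x u v w ↦ by
    simp [quasiConformalCurv, h x, h.sWedge_eq_zero, h.qWedge_eq_zero, h.scal_eq_zero]

lemma IsFlat.isMProjectivelyFlat (h : IsFlat D) : IsMProjectivelyFlat D := fun x u v w ↦ by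
  simp [mProjectiveCurv, h x, h.sWedge_eq_zero, h.qWedge_eq_zero]

end Flat

/-! ### From semi-symmetry to flatness. -/

section SemiSymmetric

variable {n : ℕ} {M : Type*} [TopologicalSpace M] [T2Space M]
  [ChartedSpace (EuclideanSpace ℝ (Fin n)) M]
  [IsManifold (𝓡 n) ∞ M] [RiemannianBundle (fun x : M ↦ TangentSpace (𝓡 n) x)]
  [IsContMDiffRiemannianBundle (𝓡 n) ∞ (EuclideanSpace ℝ (Fin n))
    (fun x : M ↦ TangentSpace (𝓡 n) x)] {D D' : Connection n M}

lemma isFlat_of_isSemiSymmetric (hn : n ≠ 0) (hD : IsLeviCivita D)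
    {ξ : Π x : M, TangentSpace (𝓡 n) x} (hξ : ∀ x, SmoothNear ξ x)
    (hξ_unit : ∀ x : M, ⟪ξ x, ξ x⟫ = 1)
    (hξ_parallel : ∀ (x : M) (v : TangentSpace (𝓡 n) x), D ξ x v = 0)
    (hD' : IsProjectiveSemiSymmetric D ξ D') (hss : IsSemiSymmetric D') : IsFlat D := by
  intro x
  have hs := smoothNear_extendVec (n := n) (M := M) (x := x)
  have hξx : ξ x ≠ 0 := fun h ↦ by simpa [h] using hξ_unit x
  refine curvature_eq_zero_of_semiSymmetric (R := curv D x) (R' := curv D' x) (ξ := ξ x)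
    (c := ((n : ℝ) / (n + 1)) ^ 2) (curv_add_right hD.smooth) (curv_smul_right hD.smooth)
    curv_swap ?_ ?_ (hξ_unit x) ?_ (by positivity) ?_ (hss x)
  · intro u v w z
    have h := inner_curvField_add_inner_curvField hD (hξ x) hξx (hs u) (hs v) (hs w) (hs z)
    simp only [FiberBundle.extend_apply_self] at h
    exact eq_neg_of_add_eq_zero_left h
  · intro u v w
    exact curvField_cyclic_sum hD.smooth hD.torsionFree (hs u) (hs v) (hs w)
  · intro u v w
    -- The fourth field is `ξ` itself, not an extension of its value, so that parallelism gives
    -- R(u,v)ξ = 0 directly.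
    have h := inner_curvField_add_inner_curvField hD (hξ x) hξx (hs u) (hs v) (hs w) (hξ x)
    have h₀ : curvField D (extendVec u) (extendVec v) ξ x = 0 := by
      have h (X : Π x : M, TangentSpace (𝓡 n) x) : (fun y ↦ D ξ y (X y)) = 0 :=
        funext fun y ↦ hξ_parallel y (X y)
      rw [curvField, h, h, hξ_parallel, D.zero]
      simp
    rw [h₀, inner_zero_right, add_zero] at h
    exact h
  · intro u v w
    have h := curvField_projectiveSemiSymmetric hD hξ hξ_parallel hD' (hs u) (hs v) (hs w)
    simp only [FiberBundle.extend_apply_self] at h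
    exact h

end SemiSymmetric

end RiemCurv

open RiemCurv in
theorem corollary4p4 {n : ℕ} (hn : 2 < n) {M : Type*} [TopologicalSpace M] [T2Space M]
    [SigmaCompactSpace M] [ChartedSpace (EuclideanSpace ℝ (Fin n)) M] [IsManifold (𝓡 n) ∞ M]
    [RiemannianBundle (fun x : M ↦ TangentSpace (𝓡 n) x)]
    [IsContMDiffRiemannianBundle (𝓡 n) ∞ (EuclideanSpace ℝ (Fin n))
      (fun x : M ↦ TangentSpace (𝓡 n) x)]
    (D D' : Connection n M) (hD : IsLeviCivita D)
    (ξ : Π x : M, TangentSpace (𝓡 n) x)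
    (hξ_smooth : ContMDiff (𝓡 n) (𝓡 n).tangent ∞ (fun x ↦ (⟨x, ξ x⟩ : TangentBundle (𝓡 n) M)))
    (hξ_unit : ∀ x : M, ⟪ξ x, ξ x⟫ = 1)
    (hξ_parallel : ∀ (x : M) (v : TangentSpace (𝓡 n) x), D ξ x v = 0)
    (hD' : IsProjectiveSemiSymmetric D ξ D')
    (hss : IsSemiSymmetric D') :
    IsFlat D ∧ IsProjectivelyFlat D ∧ IsConformallyFlat D ∧ IsConcircularlyFlat D ∧
      IsConharmonicallyFlat D ∧ IsQuasiConformallyFlat D ∧ IsMProjectivelyFlat D := by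
  have h := isFlat_of_isSemiSymmetric (by omega) hD (fun _ ↦ .of_contMDiff hξ_smooth) hξ_unit
    hξ_parallel hD' hss
  exact ⟨h, h.isProjectivelyFlat, h.isConformallyFlat, h.isConcircularlyFlat,
    h.isConharmonicallyFlat, h.isQuasiConformallyFlat, h.isMProjectivelyFlat⟩
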